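/- Let $R$ be a commutative Noetherian ring with non-zero identity. A \emph{system of ideals} of $R$ is a non-empty set $\Phi$ of ideals of $R$ such that for all $\mathfrak a_1,\mathfrak a_2\in\Phi$ there is $\mathfrak b\in\Phi$ with $\mathfrak b\subseteq\mathfrak a_1\mathfrak a_2$. For an $R$-module $X$ put $\Gamma_\Phi(X)=\{x\in X\mid \mathfrak a x=0\text{ for some }\mathfrak a\in\Phi\}$, and let $H^i_\Phi$ be the $i$-th right derived functor of $\Gamma_\Phi$. For an ideal $\mathfrak a$ of $R$ and $R$-modules $X,Y$ let $H^i_{\mathfrak a}(X)=\varinjlim_n\operatorname{Ext}^i_R(R/\mathfrak a^n,X)$ and $H^i_{\mathfrak a}(Y,X)=\varinjlim_n\operatorname{Ext}^i_R(Y/\mathfrak a^nY,X)$. For a finitely generated $R$-module $X$ let $\operatorname{grade}(\mathfrak a,X)$ be the supremum of the lengths of the $X$-regular sequences contained in $\mathfrak a$ if $\mathfrak aX\neq X$, and $+\infty$ if $\mathfrak aX=X$; let $\operatorname{grade}(\Phi,X)=\inf\{\operatorname{grade}(\mathfrak a,X)\mid\mathfrak a\in\Phi\}$. Let $\Phi$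 be a system of ideals of $R$, and let $M$, $N$ be finitely generated $R$-modules such that $\operatorname{Supp}_R(N)=V(\mathfrak a)$ for some $\mathfrak a\in\Phi$. If $\operatorname{grade}(\Phi,M)=t$ for a non-negative integer $t$, then there are isomorphisms of $R$-modules $$\operatorname{Hom}_R(N,H^t_\Phi(M))\cong\operatorname{Ext}^t_R(N,M)\cong H^t_{\mathfrak a}(N,M)\cong\operatorname{Hom}_R(N,H^t_{\mathfrak a}(M)).$$ -/

import Mathlib

open CategoryTheory

universe u

noncomputable section

/-- A system of ideals of `R`: a non-empty set of ideals such that any product of two members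
contains a member. -/
structure IdealSystem (R : Type u) [CommRing R] where
  /-- The set of ideals. -/
  carrier : Set (Ideal R)
  nonempty : carrier.Nonempty
  exists_le_mul : ∀ I ∈ carrier, ∀ J ∈ carrier, ∃ K ∈ carrier, K ≤ I * J

namespace IdealSystem

variable {R : Type u} [CommRing R] (Φ : IdealSystem R)

/-- The submodule `Γ_Φ(M) = {x ∈ M | I x = 0 for some I ∈ Φ}` of `M`. -/
def gamma (M : Type u) [AddCommGroup M] [Module R M] : Submodule R M where
  carrier := {x | ∃ I ∈ Φ.carrier, ∀ r ∈ I, r • x = 0}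
  zero_mem' := by
    obtain ⟨I, hI⟩ := Φ.nonempty
    exact ⟨I, hI, fun r _ => smul_zero r⟩
  add_mem' := by
    rintro x y ⟨I, hI, hx⟩ ⟨J, hJ, hy⟩
    obtain ⟨K, hK, hle⟩ := Φ.exists_le_mul I hI J hJ
    refine ⟨K, hK, fun r hr => ?_⟩
    have h : r ∈ I ⊓ J := Ideal.mul_le_inf (hle hr)
    rw [smul_add, hx r h.1, hy r h.2, add_zero]
  smul_mem' := by
    rintro c x ⟨I, hI, hx⟩
    exact ⟨I, hI, fun r hr => by rw [smul_comm, hx r hr, smul_zero]⟩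

theorem map_mem_gamma {M N : Type u} [AddCommGroup M] [Module R M] [AddCommGroup N] [Module R N]
    (f : M →ₗ[R] N) : ∀ x ∈ Φ.gamma M, f x ∈ Φ.gamma N := by
  rintro x ⟨I, hI, hx⟩
  exact ⟨I, hI, fun r hr => by rw [← map_smul, hx r hr, map_zero]⟩

/-- The functor `Γ_Φ` on `R`-modules; it restricts a linear map to the torsion submodules. -/
def gammaFunctor : ModuleCat.{u} R ⥤ ModuleCat.{u} R where
  obj M := ModuleCat.of R (Φ.gamma M)
  map f := ModuleCat.ofHom (f.hom.restrict (Φ.map_mem_gamma f.hom))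

instance gammaFunctor_additive : Φ.gammaFunctor.Additive where

/-- The `i`-th general local cohomology functor `H^i_Φ`: the `i`-th right derived functor
of `Γ_Φ`. -/
def generalLocalCohomology (i : ℕ) : ModuleCat.{u} R ⥤ ModuleCat.{u} R :=
  Φ.gammaFunctor.rightDerived i

end IdealSystem

/-- The grade of an ideal `I` on a (finitely generated) module `M`: it is `∞` if `I M = M`, and
otherwise the supremum of the lengths of the `M`-regular sequences in `I`. -/
def idealGrade {R : Type u} [CommRing R] (I : Ideal R) (M : Type u) [AddCommGroup M]
    [Module R M] : ℕ∞ :=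
  open Classical in
  if I • (⊤ : Submodule R M) = ⊤ then ⊤
  else ⨆ (rs : List R) (_ : RingTheory.Sequence.IsRegular M rs ∧ ∀ r ∈ rs, r ∈ I),
    (rs.length : ℕ∞)

/-- `grade(Φ, M) = inf {grade(I, M) | I ∈ Φ}`. -/
def IdealSystem.grade {R : Type u} [CommRing R] (Φ : IdealSystem R) (M : Type u)
    [AddCommGroup M] [Module R M] : ℕ∞ :=
  ⨅ I ∈ Φ.carrier, idealGrade I M

/-- The inverse system `n ↦ N / I ^ n N`, with the canonical surjections. -/
def quotientPowersDiagram {R : Type u} [CommRing R] (I : Ideal R) (N : Type u) [AddCommGroup N]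
    [Module R N] : ℕᵒᵖ ⥤ ModuleCat.{u} R where
  obj n := ModuleCat.of R (N ⧸ (I ^ n.unop • ⊤ : Submodule R N))
  map w := ModuleCat.ofHom (Submodule.mapQ _ _ LinearMap.id
    (Submodule.smul_mono_left (Ideal.pow_le_pow_right w.unop.le)))
  map_id n := by
    ext x
    simp
  map_comp v w := by
    ext x
    simp

/-- The `i`-th generalized local cohomology functor `H^i_I(N, -)`: the direct limit over `n`
of `Ext^i(N / I ^ n N, -)`. -/
def generalizedLocalCohomology {R : Type u} [CommRing R] (I : Ideal R) (i : ℕ) (N : Type u)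
    [AddCommGroup N] [Module R N] : ModuleCat.{u} R ⥤ ModuleCat.{u} R :=
  Limits.colimit ((quotientPowersDiagram I N).op ⋙ Ext R (ModuleCat.{u} R) i)

end

/-! The grade hypothesis gives `Ext^i(R/b, M) = 0` for all `i < t` and `b ∈ Φ`. Let `I` be an
injective resolution of `M`. By Artin–Rees the complex `Γ_Φ(I)` consists of injectives, and the
vanishing of Ext makes it exact below degree `t`. Its boundaries up to degree `t` are therefore
injective, so the maps onto `B^t` and from `Z^t` onto `H^t` split. If `X` is killed by a member of
`Φ`, maps `X → I` land in `Γ_Φ(I)`, and the splittings give `Ext^t(X, M) ≅ Hom(X, H)`, naturally in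
`X`, where `H = H^t_Φ(M)`.

Since `Supp N = V(a)`, some power of `a` kills `N`. Taking `X = N` gives the first isomorphism, and
the system `N/a^n N` is eventually constant, which gives the second. Taking `X = R/a^n` and passing
to the limit identifies `H^t_a(M)` with `Γ_a(H)`, and every map `N → H` lands in `Γ_a(H)`; this
gives the third. -/

noncomputable section

/-! ### Homology classes in complexes of modules. -/

section Homology

variable {R : Type u} [CommRing R] {ι : Type*} {c : ComplexShape ι}

/-- The class in homology of a cycle of a complex of modules. -/
def HomologicalComplex.homologyClass (K : HomologicalComplex (ModuleCat.{u} R) c) (n : ι) :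
    LinearMap.ker (K.d n (c.next n)).hom →ₗ[R] K.homology n :=
  (ModuleCat.Hom.hom (K.sc n).moduleCatHomologyIso.inv) ∘ₗ
    (ModuleCat.Hom.hom (K.sc n).moduleCatLeftHomologyData.π)

theorem HomologicalComplex.homologyClass_surjective
    (K : HomologicalComplex (ModuleCat.{u} R) c) (n : ι) :
    Function.Surjective (K.homologyClass n) := by
  have h1 : Function.Surjective (ModuleCat.Hom.hom (K.sc n).moduleCatHomologyIso.inv) :=
    (ModuleCat.epi_iff_surjective _).1 inferInstance
  have h2 : Function.Surjective (ModuleCat.Hom.hom (K.sc n).moduleCatLeftHomologyData.π) :=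
    (ModuleCat.epi_iff_surjective _).1 inferInstance
  exact h1.comp h2

theorem HomologicalComplex.homologyClass_eq_zero_iff
    (K : HomologicalComplex (ModuleCat.{u} R) c) (n : ι)
    (x : LinearMap.ker (K.d n (c.next n)).hom) :
    K.homologyClass n x = 0 ↔ ∃ y : K.X (c.prev n), K.d (c.prev n) n y = x.1 := by
  have h1 : Function.Injective (ModuleCat.Hom.hom (K.sc n).moduleCatHomologyIso.inv) :=
    (ModuleCat.mono_iff_injective _).1 inferInstance
  have h2 : K.homologyClass n x = 0 ↔
      ModuleCat.Hom.hom (K.sc n).moduleCatLeftHomologyData.π x = 0 :=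
    map_eq_zero_iff _ h1
  refine h2.trans ((Submodule.Quotient.mk_eq_zero
    (LinearMap.range (K.sc n).moduleCatToCycles)).trans ?_)
  constructor
  · rintro ⟨y, hy⟩
    exact ⟨y, congrArg Subtype.val hy⟩
  · rintro ⟨y, hy⟩
    exact ⟨y, Subtype.ext hy⟩

theorem HomologicalComplex.homologyMap_homologyClass
    {K L : HomologicalComplex (ModuleCat.{u} R) c} (φ : K ⟶ L) (n : ι)
    (x : LinearMap.ker (K.d n (c.next n)).hom)
    (y : LinearMap.ker (L.d n (c.next n)).hom) (h : φ.f n x.1 = y.1) :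
    HomologicalComplex.homologyMap φ n (K.homologyClass n x) = L.homologyClass n y := by
  have key : ∀ (K : HomologicalComplex (ModuleCat.{u} R) c)
      (x : LinearMap.ker (K.d n (c.next n)).hom),
      ∃ z : K.cycles n, K.homologyπ n z = K.homologyClass n x ∧ K.iCycles n z = x.1 := by
    intro K x
    refine ⟨(K.sc n).moduleCatCyclesIso.inv x, ?_, ?_⟩
    · exact ConcreteCategory.congr_hom (K.sc n).moduleCatCyclesIso_inv_π x
    · exact ConcreteCategory.congr_hom (K.sc n).moduleCatCyclesIso_inv_iCycles x
  obtain ⟨z, hz, hz'⟩ := key K x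
  obtain ⟨w, hw, hw'⟩ := key L y
  have e : HomologicalComplex.cyclesMap φ n z = w := by
    apply (ModuleCat.mono_iff_injective (L.iCycles n)).1 inferInstance
    have := ConcreteCategory.congr_hom (HomologicalComplex.cyclesMap_i φ n) z
    exact this.trans ((congrArg _ hz').trans (h.trans hw'.symm))
  rw [← hz, ← hw, ← e]
  exact ConcreteCategory.congr_hom (HomologicalComplex.homologyπ_naturality φ n) z

end Homology

/-- Two surjective linear maps with the same kernel have isomorphic targets. -/
def LinearMap.equivOfSurjectiveOfKer {R K A B : Type*} [CommRing R]
    [AddCommGroup K] [Module R K] [AddCommGroup A] [Module R A] [AddCommGroup B] [Module R B]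
    (f : K →ₗ[R] A) (g : K →ₗ[R] B) (hf : Function.Surjective f) (hg : Function.Surjective g)
    (h : ∀ x, f x = 0 ↔ g x = 0) : A ≃ₗ[R] B :=
  (f.quotKerEquivOfSurjective hf).symm ≪≫ₗ
    (Submodule.quotEquivOfEq _ _ (by ext x; exact h x)) ≪≫ₗ g.quotKerEquivOfSurjective hg

@[simp]
theorem LinearMap.equivOfSurjectiveOfKer_apply {R K A B : Type*} [CommRing R]
    [AddCommGroup K] [Module R K] [AddCommGroup A] [Module R A] [AddCommGroup B] [Module R B]
    (f : K →ₗ[R] A) (g : K →ₗ[R] B) (hf : Function.Surjective f) (hg : Function.Surjective g)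
    (h : ∀ x, f x = 0 ↔ g x = 0) (x : K) :
    LinearMap.equivOfSurjectiveOfKer f g hf hg h (f x) = g x := by
  have : (f.quotKerEquivOfSurjective hf).symm (f x) = Submodule.Quotient.mk x := by
    rw [LinearEquiv.symm_apply_eq]; rfl
  simp only [equivOfSurjectiveOfKer, LinearEquiv.trans_apply, this]
  rfl

/-! ### Cocycles with trivial class in Ext. -/

open CochainComplex HomComplex in
theorem CategoryTheory.ProjectiveResolution.extMk_eq_zero_iff_prev {C : Type*} [Category* C]
    [Abelian C] [HasExt.{u} C] {X Y : C} (P : ProjectiveResolution X) {n : ℕ}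
    (f : P.complex.X n ⟶ Y) (m : ℕ) (hm : n + 1 = m) (hf : P.complex.d m n ≫ f = 0) :
    P.extMk f m hm hf = 0 ↔ ∃ g : P.complex.X ((ComplexShape.up ℕ).prev n) ⟶ Y,
      P.complex.d n ((ComplexShape.up ℕ).prev n) ≫ g = f := by
  cases n with
  | succ n =>
    rw [CochainComplex.prev_nat_succ]
    exact P.extMk_eq_zero_iff f m hm hf n rfl
  | zero =>
    constructor
    · intro h
      replace h := congrArg P.extEquivCohomologyClass h
      rw [P.extEquivCohomologyClass_extMk, P.extEquivCohomologyClass_zero,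
        CohomologyClass.mk_eq_zero_iff,
        Cocycle.toSingleMk_mem_coboundaries_iff _ _ _ _ _ 1 (by simp)] at h
      obtain ⟨g, hg⟩ := h
      -- The resolution vanishes in cohomological degree 1, so `f` itself is zero. As `prev 0 = 0`
      -- and `d 0 0 = 0`, the stated criterion says the same.
      rw [(P.cochainComplex.isZero_of_isStrictlyLE 0 1).eq_of_src g 0, Limits.comp_zero] at hg
      refine ⟨0, ?_⟩
      rw [← cancel_epi (P.cochainComplexXIso (-(0 : ℕ)) 0 rfl).hom, ← hg]
      simp
    · rintro ⟨g, rfl⟩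
      simp

open CochainComplex HomComplex in
theorem CategoryTheory.InjectiveResolution.extMk_eq_zero_iff_prev {C : Type*} [Category* C]
    [Abelian C] [HasExt.{u} C] {X Y : C} (I : InjectiveResolution Y) {n : ℕ}
    (f : X ⟶ I.cocomplex.X n) (m : ℕ) (hm : n + 1 = m) (hf : f ≫ I.cocomplex.d n m = 0) :
    I.extMk f m hm hf = 0 ↔ ∃ g : X ⟶ I.cocomplex.X ((ComplexShape.up ℕ).prev n),
      g ≫ I.cocomplex.d ((ComplexShape.up ℕ).prev n) n = f := by
  cases n with
  | succ n =>
    rw [CochainComplex.prev_nat_succ]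
    exact I.extMk_eq_zero_iff f m hm hf n rfl
  | zero =>
    constructor
    · intro h
      replace h := congrArg I.extEquivCohomologyClass h
      rw [I.extEquivCohomologyClass_extMk, I.extEquivCohomologyClass_zero,
        CohomologyClass.mk_eq_zero_iff,
        Cocycle.fromSingleMk_mem_coboundaries_iff _ _ _ _ _ (-1) (by simp)] at h
      obtain ⟨g, hg⟩ := h
      rw [(I.cochainComplex.isZero_of_isStrictlyGE 0 (-1)).eq_of_tgt g 0, Limits.zero_comp] at hg
      refine ⟨0, ?_⟩
      rw [← cancel_mono (I.cochainComplexXIso (0 : ℕ) 0 rfl).inv, ← hg]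
      simp
    · rintro ⟨g, rfl⟩
      simp

/-! ### Derived-functor Ext versus `Abelian.Ext`. -/

section

variable {R : Type u} [CommRing R]

/-- The morphism of complexes `Hom(Q, Y) ⟶ Hom(P, Y)` induced by `P ⟶ Q`. -/
def ChainComplex.linearYonedaMap {P Q : ChainComplex (ModuleCat.{u} R) ℕ} (φ : P ⟶ Q)
    (Y : ModuleCat.{u} R) : Q.linearYonedaObj R Y ⟶ P.linearYonedaObj R Y :=
  (HomologicalComplex.unopFunctor _ _).map
    ((((linearYoneda R (ModuleCat.{u} R)).obj Y).rightOp.mapHomologicalComplex _).map φ).op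

/-- `isoExt` is a composite: a left derived functor into the opposite category, then the homology of
an opposite complex. `h1` and `h2` are the naturality of the two factors. -/
theorem CategoryTheory.ProjectiveResolution.isoExt_naturality {X X' : ModuleCat.{u} R}
    (f : X ⟶ X') (P : ProjectiveResolution X) (Q : ProjectiveResolution X')
    (φ : P.complex ⟶ Q.complex) (comm : φ.f 0 ≫ Q.π.f 0 = P.π.f 0 ≫ f) (n : ℕ)
    (Y : ModuleCat.{u} R) :
    ((Ext R (ModuleCat.{u} R) n).map f.op).app Y ≫ (P.isoExt (R := R) n Y).hom =
      (Q.isoExt (R := R) n Y).hom ≫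
        HomologicalComplex.homologyMap (ChainComplex.linearYonedaMap φ Y) n := by
  have h1 : ((Ext R (ModuleCat.{u} R) n).map f.op).app Y ≫
      (P.isoLeftDerivedObj ((linearYoneda R (ModuleCat.{u} R)).obj Y).rightOp n).inv.unop =
      (Q.isoLeftDerivedObj ((linearYoneda R (ModuleCat.{u} R)).obj Y).rightOp n).inv.unop ≫
        (HomologicalComplex.homologyMap ((HomologicalComplex.opFunctor _ _).map
          (ChainComplex.linearYonedaMap φ Y).op) n).unop :=
    congrArg Quiver.Hom.unop (ProjectiveResolution.isoLeftDerivedObj_inv_naturality f P Q φ comm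
      ((linearYoneda R (ModuleCat.{u} R)).obj Y).rightOp n)
  have h2 : (HomologicalComplex.homologyMap ((HomologicalComplex.opFunctor _ _).map
        (ChainComplex.linearYonedaMap φ Y).op) n).unop ≫
      ((P.complex.linearYonedaObj R Y).homologyOp n).inv.unop =
      ((Q.complex.linearYonedaObj R Y).homologyOp n).inv.unop ≫
        HomologicalComplex.homologyMap (ChainComplex.linearYonedaMap φ Y) n := by
    apply Quiver.Hom.op_inj
    have : CommSq ((P.complex.linearYonedaObj R Y).homologyOp n).hom
        (HomologicalComplex.homologyMap ((HomologicalComplex.opFunctor _ _).map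
          (ChainComplex.linearYonedaMap φ Y).op) n)
        (HomologicalComplex.homologyMap (ChainComplex.linearYonedaMap φ Y) n).op
        ((Q.complex.linearYonedaObj R Y).homologyOp n).hom :=
      ⟨(HomologicalComplex.homologyOp_hom_naturality (ChainComplex.linearYonedaMap φ Y) n).symm⟩
    exact this.horiz_inv.w
  change _ ≫ _ ≫ _ = (_ ≫ _) ≫ _
  refine (Category.assoc _ _ _).symm.trans ((congrArg (· ≫ _) h1).trans ?_)
  refine (Category.assoc _ _ _).trans (Eq.trans ?_ (Category.assoc _ _ _).symm)
  exact congrArg _ h2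

/-- The linear map sending a cocycle `P_n → Y` to its class in `Ext`. -/
def CategoryTheory.ProjectiveResolution.extMkLinear {X : ModuleCat.{u} R}
    (P : ProjectiveResolution X) (Y : ModuleCat.{u} R) (n : ℕ) :
    LinearMap.ker ((P.complex.linearYonedaObj R Y).d n ((ComplexShape.up ℕ).next n)).hom →ₗ[R]
      Abelian.Ext X Y n where
  toFun f := P.extMk (show P.complex.X n ⟶ Y from f.1) _ (by simp) f.2
  map_add' f g := (P.add_extMk _ _ _ _ f.2 g.2).symm
  map_smul' r f := by
    rw [Abelian.Ext.smul_eq_comp_mk₀]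
    refine Eq.trans ?_ (P.extMk_comp_mk₀ (show P.complex.X n ⟶ Y from f.1) _ (by simp) f.2
      (r • 𝟙 Y)).symm
    congr 1

theorem CategoryTheory.ProjectiveResolution.extMkLinear_surjective {X : ModuleCat.{u} R}
    (P : ProjectiveResolution X) (Y : ModuleCat.{u} R) (n : ℕ) :
    Function.Surjective (P.extMkLinear Y n) := by
  intro e
  obtain ⟨f, hf, rfl⟩ := P.extMk_surjective e ((ComplexShape.up ℕ).next n) (by simp)
  exact ⟨⟨f, hf⟩, rfl⟩

theorem CategoryTheory.ProjectiveResolution.extMkLinear_eq_zero_iff {X : ModuleCat.{u} R}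
    (P : ProjectiveResolution X) (Y : ModuleCat.{u} R) (n : ℕ)
    (f : LinearMap.ker
      ((P.complex.linearYonedaObj R Y).d n ((ComplexShape.up ℕ).next n)).hom) :
    HomologicalComplex.homologyClass _ n f = 0 ↔ P.extMkLinear Y n f = 0 :=
  (HomologicalComplex.homologyClass_eq_zero_iff _ n f).trans
    (P.extMk_eq_zero_iff_prev (show P.complex.X n ⟶ Y from f.1) _ (by simp) f.2).symm

/-- The two models of `Ext` in module categories agree. -/
def extEquivAbelianExt (n : ℕ) (X Y : ModuleCat.{u} R) :
    ((Ext R (ModuleCat.{u} R) n).obj (Opposite.op X)).obj Y ≃ₗ[R] Abelian.Ext X Y n :=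
  ((projectiveResolution X).isoExt (R := R) n Y).toLinearEquiv ≪≫ₗ
    LinearMap.equivOfSurjectiveOfKer
      (HomologicalComplex.homologyClass _ n) ((projectiveResolution X).extMkLinear Y n)
      (HomologicalComplex.homologyClass_surjective _ n)
      ((projectiveResolution X).extMkLinear_surjective Y n)
      ((projectiveResolution X).extMkLinear_eq_zero_iff Y n)

theorem extEquivAbelianExt_eq (n : ℕ) (X Y : ModuleCat.{u} R)
    (e : ((Ext R (ModuleCat.{u} R) n).obj (Opposite.op X)).obj Y)
    (z : LinearMap.ker (((projectiveResolution X).complex.linearYonedaObj R Y).d n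
      ((ComplexShape.up ℕ).next n)).hom)
    (h : ((projectiveResolution X).isoExt (R := R) n Y).hom e =
      HomologicalComplex.homologyClass _ n z) :
    extEquivAbelianExt n X Y e = (projectiveResolution X).extMkLinear Y n z := by
  refine (congrArg (LinearMap.equivOfSurjectiveOfKer
    (HomologicalComplex.homologyClass _ n) ((projectiveResolution X).extMkLinear Y n)
    (HomologicalComplex.homologyClass_surjective _ n)
    ((projectiveResolution X).extMkLinear_surjective Y n)
    ((projectiveResolution X).extMkLinear_eq_zero_iff Y n)) h).trans ?_
  exact LinearMap.equivOfSurjectiveOfKer_apply _ _ _ _ _ _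

/-- Both sides are represented by one cocycle `z`, precomposed with a lift of `f` to the projective
resolutions. -/
theorem extEquivAbelianExt_naturality (n : ℕ) {X X' : ModuleCat.{u} R} (f : X ⟶ X')
    (Y : ModuleCat.{u} R) (e : ((Ext R (ModuleCat.{u} R) n).obj (Opposite.op X')).obj Y) :
    extEquivAbelianExt n X Y (((Ext R (ModuleCat.{u} R) n).map f.op).app Y e) =
      (Abelian.Ext.mk₀ f).comp (extEquivAbelianExt n X' Y e) (zero_add _) := by
  let P := projectiveResolution X
  let Q := projectiveResolution X'
  let φ : ProjectiveResolution.Hom P Q f :=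
    { hom := ProjectiveResolution.lift f P Q
      hom_f_zero_comp_π_f_zero := ProjectiveResolution.lift_commutes_zero f P Q }
  have comm : φ.hom.f 0 ≫ Q.π.f 0 = P.π.f 0 ≫ f := φ.hom_f_zero_comp_π_f_zero
  obtain ⟨z, hz⟩ := HomologicalComplex.homologyClass_surjective
    (Q.complex.linearYonedaObj R Y) n ((Q.isoExt (R := R) n Y).hom e)
  have hz' : P.complex.d ((ComplexShape.up ℕ).next n) n ≫
      φ.hom.f n ≫ (show Q.complex.X n ⟶ Y from z.1) = 0 := by
    rw [← φ.hom.comm_assoc]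
    refine Eq.trans (congrArg _ z.2) (Limits.comp_zero)
  have h2 : (P.isoExt (R := R) n Y).hom (((Ext R (ModuleCat.{u} R) n).map f.op).app Y e) =
      HomologicalComplex.homologyClass (P.complex.linearYonedaObj R Y) n
        ⟨φ.hom.f n ≫ (show Q.complex.X n ⟶ Y from z.1), hz'⟩ := by
    refine (ConcreteCategory.congr_hom
      (ProjectiveResolution.isoExt_naturality f P Q φ.hom comm n Y) e).trans ?_
    refine (congrArg (HomologicalComplex.homologyMap
      (ChainComplex.linearYonedaMap φ.hom Y) n) hz.symm).trans ?_
    exact HomologicalComplex.homologyMap_homologyClass _ n _ _ rfl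
  rw [extEquivAbelianExt_eq n X' Y e z hz.symm, extEquivAbelianExt_eq n X Y _ _ h2]
  exact (ProjectiveResolution.mk₀_comp_extMk (R := Q) (R' := P)
    (show Q.complex.X n ⟶ Y from z.1) _ (by simp) z.2 φ).symm

end

/-! ### Splittings from injective kernels. -/

section Splitting

variable {R : Type u} [CommRing R] {A B : Type u} [AddCommGroup A] [Module R A]
  [AddCommGroup B] [Module R B]

theorem Module.Injective.of_retract [Module.Injective R A] (s : B →ₗ[R] A) (p : A →ₗ[R] B)
    (h : ∀ x, p (s x) = x) : Module.Injective R B where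
  out X Y _ _ _ _ f hf g := by
    obtain ⟨k, hk⟩ := Module.Injective.out f hf (s ∘ₗ g)
    exact ⟨p ∘ₗ k, fun x => by simp [hk, h]⟩

theorem LinearMap.exists_section_of_injective_ker (f : A →ₗ[R] B) (hf : Function.Surjective f)
    [Module.Injective R (LinearMap.ker f)] : ∃ s : B →ₗ[R] A, ∀ y, f (s y) = y := by
  obtain ⟨ρ, hρ⟩ := Module.Injective.out (LinearMap.ker f).subtype
    (LinearMap.ker f).injective_subtype LinearMap.id
  -- With `ρ` a retraction onto the kernel, `x - ρ x` depends only on `f x`, hence descends to a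
  -- section.
  let q : A →ₗ[R] A := LinearMap.id - (LinearMap.ker f).subtype ∘ₗ ρ
  have hq : LinearMap.ker f ≤ LinearMap.ker q := by
    intro x hx
    have := hρ ⟨x, hx⟩
    simp only [Submodule.subtype_apply, LinearMap.id_apply] at this
    simp [q, this]
  refine ⟨(LinearMap.ker f).liftQ q hq ∘ₗ (f.quotKerEquivOfSurjective hf).symm.toLinearMap, ?_⟩
  intro y
  obtain ⟨x, rfl⟩ := hf y
  have : (f.quotKerEquivOfSurjective hf).symm (f x) = Submodule.Quotient.mk x := by
    rw [LinearEquiv.symm_apply_eq]; rfl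
  simp [this, q]

theorem LinearMap.exists_section_range_of_injective [Module.Injective R A] (f : A →ₗ[R] B)
    [Module.Injective R (LinearMap.ker f)] :
    Module.Injective R (LinearMap.range f) ∧
      ∃ s : LinearMap.range f →ₗ[R] A, ∀ y, f (s y) = y := by
  have : Module.Injective R (LinearMap.ker f.rangeRestrict) := by
    rw [LinearMap.ker_rangeRestrict]; infer_instance
  obtain ⟨s, hs⟩ := f.rangeRestrict.exists_section_of_injective_ker f.surjective_rangeRestrict
  exact ⟨Module.Injective.of_retract s _ hs, s, fun y => congrArg Subtype.val (hs y)⟩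

end Splitting

/-! ### Complexes of injectives that are exact below degree `t`. -/

namespace CochainComplex

variable {R : Type u} [CommRing R] (G : CochainComplex (ModuleCat.{u} R) ℕ)
  (hG : ∀ i, Module.Injective R (G.X i)) (t : ℕ)
  (hex : ∀ i < t, ∀ x, G.d i ((ComplexShape.up ℕ).next i) x = 0 →
    ∃ y, G.d ((ComplexShape.up ℕ).prev i) i y = x)
include hG hex

/-- Induction: `B^0 = 0`, and `B^(i+1)` is `G^i` modulo `Z^i = B^i`, which is injective and so
splits off. -/
theorem boundaries_injective_and_exists_section (i : ℕ) (hi : i ≤ t) :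
    Module.Injective R (LinearMap.range (G.d ((ComplexShape.up ℕ).prev i) i).hom) ∧
      ∃ s : LinearMap.range (G.d ((ComplexShape.up ℕ).prev i) i).hom →ₗ[R]
        G.X ((ComplexShape.up ℕ).prev i),
        ∀ y, (G.d ((ComplexShape.up ℕ).prev i) i).hom (s y) = y := by
  induction i with
  | zero =>
    have h1 : ∀ y : LinearMap.range (G.d ((ComplexShape.up ℕ).prev 0) 0).hom, y = 0 := by
      rintro ⟨_, x, rfl⟩
      ext
      simp
    refine ⟨⟨fun X Y _ _ _ _ f hf g => ⟨0, fun x => (h1 _).symm⟩⟩, 0, fun y => ?_⟩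
    rw [h1 y]
    simp
  | succ i ih =>
    have := (ih (by omega)).1
    rw [CochainComplex.prev_nat_succ]
    have hk : LinearMap.ker (G.d i (i + 1)).hom =
        LinearMap.range (G.d ((ComplexShape.up ℕ).prev i) i).hom := by
      ext x
      constructor
      · intro hx
        have := hex i (by omega) x
        rw [CochainComplex.next] at this
        exact this hx
      · rintro ⟨y, rfl⟩
        exact ConcreteCategory.congr_hom (G.d_comp_d _ i (i + 1)) y
    have : Module.Injective R (LinearMap.ker (G.d i (i + 1)).hom) := by rwa [hk]
    have := hG i
    exact LinearMap.exists_section_range_of_injective (G.d i (i + 1)).hom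

/-- The kernel of `Z^t → H^t` is a copy of the injective module `B^t`. -/
theorem exists_section_homologyClass :
    ∃ s : G.homology t →ₗ[R] LinearMap.ker (G.d t ((ComplexShape.up ℕ).next t)).hom,
      ∀ y, G.homologyClass t (s y) = y := by
  have hB := (boundaries_injective_and_exists_section G hG t hex t le_rfl).1
  have hle : ∀ x : LinearMap.range (G.d ((ComplexShape.up ℕ).prev t) t).hom,
      (G.d t ((ComplexShape.up ℕ).next t)).hom x.1 = 0 := by
    rintro ⟨_, y, rfl⟩
    exact ConcreteCategory.congr_hom (G.d_comp_d _ t _) y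
  have : Module.Injective R (LinearMap.ker (G.homologyClass t)) := by
    refine Module.Injective.of_retract
      (A := LinearMap.range (G.d ((ComplexShape.up ℕ).prev t) t).hom)
      (LinearMap.codRestrict _ ((LinearMap.ker (G.d t ((ComplexShape.up ℕ).next t)).hom).subtype ∘ₗ
        (LinearMap.ker (G.homologyClass t)).subtype) ?_)
      (LinearMap.codRestrict _ (LinearMap.codRestrict _ (Submodule.subtype _) hle) ?_) ?_
    · intro x
      exact (G.homologyClass_eq_zero_iff t x.1).1 x.2
    · intro x
      exact (G.homologyClass_eq_zero_iff t _).2 x.2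
    · intro x
      rfl
  exact LinearMap.exists_section_of_injective_ker _ (G.homologyClass_surjective t)

theorem exists_eq_d_comp_of_homologyClass_comp_eq_zero {X : Type u} [AddCommGroup X] [Module R X]
    (f : X →ₗ[R] LinearMap.ker (G.d t ((ComplexShape.up ℕ).next t)).hom)
    (hf : G.homologyClass t ∘ₗ f = 0) :
    ∃ g : X →ₗ[R] G.X ((ComplexShape.up ℕ).prev t),
      (G.d ((ComplexShape.up ℕ).prev t) t).hom ∘ₗ g = Submodule.subtype _ ∘ₗ f := by
  obtain ⟨s, hs⟩ := (boundaries_injective_and_exists_section G hG t hex t le_rfl).2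
  refine ⟨s ∘ₗ LinearMap.codRestrict _ (Submodule.subtype _ ∘ₗ f) ?_, ?_⟩
  · intro x
    exact (G.homologyClass_eq_zero_iff t (f x)).1 (LinearMap.congr_fun hf x)
  · ext x
    exact hs _

end CochainComplex

/-! ### `Γ_Φ` preserves injectivity over a Noetherian ring. -/

namespace IdealSystem

variable {R : Type u} [CommRing R] (Φ : IdealSystem R)

theorem exists_le_inf {I J : Ideal R} (hI : I ∈ Φ.carrier) (hJ : J ∈ Φ.carrier) :
    ∃ K ∈ Φ.carrier, K ≤ I ∧ K ≤ J := by
  obtain ⟨K, hK, h⟩ := Φ.exists_le_mul I hI J hJ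
  exact ⟨K, hK, h.trans Ideal.mul_le_left, h.trans Ideal.mul_le_right⟩

theorem exists_le_pow {I : Ideal R} (hI : I ∈ Φ.carrier) (n : ℕ) :
    ∃ K ∈ Φ.carrier, K ≤ I ^ n := by
  induction n with
  | zero => exact ⟨I, hI, by simp⟩
  | succ n ih =>
    obtain ⟨J, hJ, hle⟩ := ih
    obtain ⟨K, hK, h⟩ := Φ.exists_le_mul J hJ I hI
    exact ⟨K, hK, h.trans (by rw [pow_succ]; exact Ideal.mul_mono_left hle)⟩

theorem exists_forall_smul_eq_zero {M : Type u} [AddCommGroup M] [Module R M]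
    {N : Submodule R M} (hN : N.FG) (h : N ≤ Φ.gamma M) :
    ∃ I ∈ Φ.carrier, ∀ r ∈ I, ∀ x ∈ N, r • x = 0 := by
  induction N, hN using Submodule.fg_induction with
  | singleton x =>
    obtain ⟨I, hI, hx⟩ := h (Submodule.mem_span_singleton_self x)
    refine ⟨I, hI, fun r hr y hy => ?_⟩
    obtain ⟨c, rfl⟩ := Submodule.mem_span_singleton.1 hy
    rw [smul_comm, hx r hr, smul_zero]
  | sup N₁ N₂ _ _ h₁ h₂ =>
    obtain ⟨I, hI, hx⟩ := h₁ (le_sup_left.trans h)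
    obtain ⟨J, hJ, hy⟩ := h₂ (le_sup_right.trans h)
    obtain ⟨K, hK, hKI, hKJ⟩ := Φ.exists_le_inf hI hJ
    refine ⟨K, hK, fun r hr z hz => ?_⟩
    obtain ⟨x, hx', y, hy', rfl⟩ := Submodule.mem_sup.1 hz
    rw [smul_add, hx r (hKI hr) x hx', hy r (hKJ hr) y hy', add_zero]

/-- Baer's criterion. The image of `g : J → Γ_Φ(M)` is finitely generated, so some `b ∈ Φ` kills it.
By Artin–Rees `g` kills `J ∩ c` for a power `c` of `b`; it then extends from `J/(J ∩ c)` to `R/c`,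
whose image in `M` is killed by `c` and hence lies in `Γ_Φ(M)`. -/
theorem gamma_injective [IsNoetherianRing R] (M : Type u) [AddCommGroup M] [Module R M]
    [Module.Injective R M] : Module.Injective R (Φ.gamma M) := by
  refine Module.Baer.injective fun J g => ?_
  obtain ⟨b, hb, hbg⟩ := Φ.exists_forall_smul_eq_zero
    (N := LinearMap.range ((Φ.gamma M).subtype ∘ₗ g)) (Submodule.FG.of_finite)
    (by rintro _ ⟨x, rfl⟩; exact (g x).2)
  obtain ⟨k, hk⟩ := Ideal.exists_pow_inf_eq_pow_smul b (M := R) J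
  -- One more than the Artin–Rees exponent leaves exactly one factor `b` outside.
  have hk := hk (k + 1) (by omega)
  have hle : b ^ (k + 1) ⊓ J ≤ b • J := by
    simp only [Nat.add_sub_cancel_left, pow_one, smul_eq_mul, Ideal.mul_top] at hk
    rw [hk]
    exact Ideal.mul_mono_right inf_le_right
  let c := b ^ (k + 1)
  have hg : ∀ x : J, x.1 ∈ c → g x = 0 := by
    intro x hx
    have hker : b • J ≤ (LinearMap.ker g).map (Submodule.subtype J) := by
      refine Submodule.smul_le.2 fun r hr z hz => ⟨r • ⟨z, hz⟩, ?_, rfl⟩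
      rw [SetLike.mem_coe, LinearMap.mem_ker, map_smul]
      ext
      exact hbg r hr _ ⟨⟨z, hz⟩, rfl⟩
    obtain ⟨y, hy, hyx⟩ := hker (hle ⟨hx, x.2⟩)
    rwa [← Subtype.ext hyx]
  obtain ⟨h, hh⟩ := Module.Injective.out
    (Submodule.mapQ (Submodule.comap (Submodule.subtype J) c) c (Submodule.subtype J) le_rfl)
    (by
      rw [← LinearMap.ker_eq_bot, Submodule.mapQ, Submodule.ker_liftQ, LinearMap.ker_comp,
        Submodule.ker_mkQ, Submodule.mkQ_map_self])
    (Submodule.liftQ (Submodule.comap (Submodule.subtype J) c) ((Φ.gamma M).subtype ∘ₗ g)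
      (by intro x hx; simp [hg x hx]))
  refine ⟨LinearMap.codRestrict _ (h ∘ₗ c.mkQ) ?_, ?_⟩
  · intro x
    obtain ⟨d, hd, hdc⟩ := Φ.exists_le_pow hb (k + 1)
    refine ⟨d, hd, fun r hr => ?_⟩
    rw [← map_smul]
    have : c.mkQ (r • x) = 0 := (Submodule.Quotient.mk_eq_zero c).2 (c.mul_mem_right x (hdc hr))
    rw [LinearMap.comp_apply, this, map_zero]
  · intro x hx
    ext
    exact hh (Submodule.Quotient.mk ⟨x, hx⟩)

end IdealSystem

/-! ### Vanishing of Ext below the grade. -/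

theorem CategoryTheory.InjectiveResolution.smul_extMk {R : Type u} [CommRing R]
    {X M : ModuleCat.{u} R} (I : InjectiveResolution M) {n : ℕ} (r : R)
    (f : X ⟶ I.cocomplex.X n) (m : ℕ) (hm : n + 1 = m) (hf : f ≫ I.cocomplex.d n m = 0) :
    r • I.extMk f m hm hf = I.extMk (r • f) m hm
      (by rw [Linear.smul_comp, hf, smul_zero]) := by
  rw [← Abelian.Ext.mk₀_id_comp (I.extMk f m hm hf), ← Abelian.Ext.smul_comp,
    ← Abelian.Ext.mk₀_smul, I.mk₀_comp_extMk]
  congr 1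
  rw [Linear.smul_comp, Category.id_comp]

/-- Nakayama gives `r ∈ 1 + I` with `rM = 0`. Then `r` kills Ext through `M` and `r - 1` kills it
through `R/I`, so `1` kills it. -/
theorem subsingleton_ext_of_smul_top_eq_top {R : Type u} [CommRing R] (I : Ideal R) (M : Type u)
    [AddCommGroup M] [Module R M] [Module.Finite R M] (h : I • (⊤ : Submodule R M) = ⊤) (i : ℕ) :
    Subsingleton (Abelian.Ext (ModuleCat.of R (R ⧸ I)) (ModuleCat.of R M) i) := by
  obtain ⟨r, hrI, hr⟩ := Submodule.exists_sub_one_mem_and_smul_eq_zero_of_fg_of_le_smul I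
    (⊤ : Submodule R M) Module.Finite.fg_top h.ge
  have h1 : r • 𝟙 (ModuleCat.of R M) = 0 := by
    ext x
    exact hr x trivial
  have h2 : (r - 1) • 𝟙 (ModuleCat.of R (R ⧸ I)) = 0 := by
    ext
    exact (Ideal.Quotient.eq_zero_iff_mem).2 (I.mul_mem_right _ hrI)
  refine subsingleton_of_forall_eq 0 fun e => ?_
  have e1 : r • e = 0 := by
    rw [Abelian.Ext.smul_eq_comp_mk₀, h1]
    simp
  have e2 : (r - 1) • e = 0 := by
    rw [← Abelian.Ext.mk₀_id_comp e, ← Abelian.Ext.smul_comp, ← Abelian.Ext.mk₀_smul, h2]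
    simp
  have := congrArg₂ (· - ·) e1 e2
  simpa [sub_smul] using this

theorem subsingleton_ext_of_lt_idealGrade {R : Type u} [CommRing R] [IsNoetherianRing R]
    (I : Ideal R) (M : Type u) [AddCommGroup M] [Module R M] [Module.Finite R M] (i : ℕ)
    (hi : (i : ℕ∞) < idealGrade I M) :
    Subsingleton (Abelian.Ext (ModuleCat.of R (R ⧸ I)) (ModuleCat.of R M) i) := by
  by_cases h : I • (⊤ : Submodule R M) = ⊤
  · exact subsingleton_ext_of_smul_top_eq_top I M h i
  · rw [idealGrade, if_neg h] at hi
    simp only [lt_iSup_iff, Nat.cast_lt] at hi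
    obtain ⟨rs, ⟨hreg, hmem⟩, hlt⟩ := hi
    refine ModuleCat.subsingleton_ext_of_exists_isRegular I (ModuleCat.of R (R ⧸ I)) ?_
      (ModuleCat.of R M) (lt_top_iff_ne_top.2 h) rs hmem hreg i hlt
    rw [Module.support_eq_zeroLocus, Ideal.annihilator_quotient]

/-! ### The isomorphism `Ext^n(X, M) ≅ Hom(X, H^n_Φ(M))`. -/

namespace IdealSystem

variable {R : Type u} [CommRing R] (Φ : IdealSystem R)

/-- A module annihilated by a member of `Φ`. -/
def Annihilates (X : Type u) [AddCommGroup X] [Module R X] : Prop :=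
  ∃ I ∈ Φ.carrier, ∀ r ∈ I, ∀ x : X, r • x = 0

variable {Φ} in
theorem Annihilates.map_mem_gamma {X Y : Type u} [AddCommGroup X] [Module R X] [AddCommGroup Y]
    [Module R Y] (hX : Φ.Annihilates X) (f : X →ₗ[R] Y) (x : X) : f x ∈ Φ.gamma Y := by
  obtain ⟨I, hI, h⟩ := hX
  exact ⟨I, hI, fun r hr => by rw [← map_smul, h r hr, map_zero]⟩

variable {M : ModuleCat.{u} R} (I : InjectiveResolution M)

/-- The complex `Γ_Φ(I)` for an injective resolution `I`. -/
abbrev gammaComplex : CochainComplex (ModuleCat.{u} R) ℕ :=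
  (Φ.gammaFunctor.mapHomologicalComplex _).obj I.cocomplex

/-- The cocycles of `Γ_Φ(I)` in degree `n`. -/
abbrev gammaCocycles (n : ℕ) : Submodule R ((Φ.gammaComplex I).X n) :=
  LinearMap.ker ((Φ.gammaComplex I).d n ((ComplexShape.up ℕ).next n)).hom

theorem gammaComplex_injective [IsNoetherianRing R] (i : ℕ) :
    Module.Injective R ((Φ.gammaComplex I).X i) := by
  have : Module.Injective R (I.cocomplex.X i) :=
    Module.injective_module_of_injective_object R (I.cocomplex.X i)
      (inj := I.injective i)
  exact Φ.gamma_injective (I.cocomplex.X i)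

/-- A cocycle killed by `b` is a cocycle `R/b → I^i`. Its class vanishes, and the image of `1` under
a bounding map is killed by `b`, so it stays in `Γ_Φ`. -/
theorem gammaComplex_exact (i : ℕ)
    (h : ∀ b ∈ Φ.carrier, Subsingleton (Abelian.Ext (ModuleCat.of R (R ⧸ b)) M i))
    (x : (Φ.gammaComplex I).X i)
    (hx : (Φ.gammaComplex I).d i ((ComplexShape.up ℕ).next i) x = 0) :
    ∃ y, (Φ.gammaComplex I).d ((ComplexShape.up ℕ).prev i) i y = x := by
  obtain ⟨b, hb, hbx⟩ := x.2
  have := h b hb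
  have hdx : I.cocomplex.d i ((ComplexShape.up ℕ).next i) x.1 = 0 := congrArg Subtype.val hx
  let f : ModuleCat.of R (R ⧸ b) ⟶ I.cocomplex.X i :=
    ModuleCat.ofHom (Submodule.liftQ b (LinearMap.toSpanSingleton R _ x.1) hbx)
  have hf : f ≫ I.cocomplex.d i ((ComplexShape.up ℕ).next i) = 0 := by
    ext
    change I.cocomplex.d i ((ComplexShape.up ℕ).next i) ((1 : R) • x.1) = 0
    rw [one_smul, hdx]
  obtain ⟨g, hg⟩ := (I.extMk_eq_zero_iff_prev f _ (by simp) hf).1 (Subsingleton.elim _ _)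
  refine ⟨⟨g (Submodule.Quotient.mk 1), b, hb, fun r hr => ?_⟩, Subtype.ext ?_⟩
  · have : r • (Submodule.Quotient.mk (1 : R) : R ⧸ b) = 0 :=
      (Submodule.Quotient.mk_eq_zero b).2 (b.mul_mem_right _ hr)
    exact (g.hom.map_smul r _).symm.trans ((congrArg g.hom this).trans (map_zero g.hom))
  · refine (ConcreteCategory.congr_hom hg (Submodule.Quotient.mk 1)).trans ?_
    exact one_smul R x.1

section

variable (n : ℕ)

/-- The inclusion of the cocycles of `Γ_Φ(I)` in `I`. -/
def gammaCocyclesι : ModuleCat.of R (Φ.gammaCocycles I n) ⟶ I.cocomplex.X n :=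
  ModuleCat.ofHom (Φ.gammaCocycles I n).subtype ≫ ModuleCat.ofHom (Φ.gamma _).subtype

theorem gammaCocyclesι_d :
    Φ.gammaCocyclesι I n ≫ I.cocomplex.d n ((ComplexShape.up ℕ).next n) = 0 := by
  ext x
  exact congrArg Subtype.val x.2

variable (X : ModuleCat.{u} R)

/-- The class in `Ext(X, M)` of a linear map from `X` to the cocycles of `Γ_Φ(I)`. -/
def extMkGamma : (X →ₗ[R] Φ.gammaCocycles I n) →ₗ[R] Abelian.Ext X M n where
  toFun f := I.extMk (ModuleCat.ofHom f ≫ Φ.gammaCocyclesι I n) ((ComplexShape.up ℕ).next n)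
    (by simp) (by rw [Category.assoc, gammaCocyclesι_d, Limits.comp_zero])
  map_add' f g := by
    rw [I.add_extMk]
    congr 1
  map_smul' r f := by
    rw [RingHom.id_apply, I.smul_extMk]
    congr 1

variable {X}

theorem extMkGamma_comp {X' : ModuleCat.{u} R} (g : X' ⟶ X) (f : X →ₗ[R] Φ.gammaCocycles I n) :
    Φ.extMkGamma I n X' (f ∘ₗ g.hom) =
      (Abelian.Ext.mk₀ g).comp (Φ.extMkGamma I n X f) (zero_add _) := by
  refine Eq.trans ?_ (I.mk₀_comp_extMk (ModuleCat.ofHom f ≫ Φ.gammaCocyclesι I n)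
    ((ComplexShape.up ℕ).next n) (by simp)
    (by rw [Category.assoc, gammaCocyclesι_d, Limits.comp_zero]) g).symm
  rfl

theorem extMkGamma_surjective (hX : Φ.Annihilates X) :
    Function.Surjective (Φ.extMkGamma I n X) := by
  intro e
  obtain ⟨f, hf, rfl⟩ := I.extMk_surjective e ((ComplexShape.up ℕ).next n) (by simp)
  refine ⟨LinearMap.codRestrict (Φ.gammaCocycles I n)
    (LinearMap.codRestrict (Φ.gamma _) f.hom (hX.map_mem_gamma f.hom)) ?_, rfl⟩
  intro x
  exact Subtype.ext (ConcreteCategory.congr_hom hf x)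

/-- A bounding map from `X` lands in `Γ_Φ(I)` because `X` is annihilated. Conversely, a map into
boundaries lifts along the section of the differential onto `B^n`. -/
theorem extMkGamma_eq_zero_iff [IsNoetherianRing R] (hX : Φ.Annihilates X)
    (hM : ∀ i < n, ∀ b ∈ Φ.carrier, Subsingleton (Abelian.Ext (ModuleCat.of R (R ⧸ b)) M i))
    (f : X →ₗ[R] Φ.gammaCocycles I n) :
    Φ.extMkGamma I n X f = 0 ↔ (Φ.gammaComplex I).homologyClass n ∘ₗ f = 0 := by
  refine (I.extMk_eq_zero_iff_prev (ModuleCat.ofHom f ≫ Φ.gammaCocyclesι I n)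
    ((ComplexShape.up ℕ).next n) (by simp)
    (by rw [Category.assoc, gammaCocyclesι_d, Limits.comp_zero])).trans ⟨?_, ?_⟩
  · rintro ⟨g, hg⟩
    ext x
    refine ((Φ.gammaComplex I).homologyClass_eq_zero_iff n (f x)).2
      ⟨⟨g x, hX.map_mem_gamma g.hom x⟩, Subtype.ext ?_⟩
    exact ConcreteCategory.congr_hom hg x
  · intro h
    obtain ⟨g, hg⟩ := CochainComplex.exists_eq_d_comp_of_homologyClass_comp_eq_zero
      (Φ.gammaComplex I) (Φ.gammaComplex_injective I) n
      (fun i hi x hx => Φ.gammaComplex_exact I i (hM i hi) x hx) f h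
    refine ⟨ModuleCat.ofHom g ≫ ModuleCat.ofHom (Φ.gamma _).subtype, ?_⟩
    ext x
    exact congrArg Subtype.val (LinearMap.congr_fun hg x)

theorem homologyClass_comp_surjective [IsNoetherianRing R]
    (hM : ∀ i < n, ∀ b ∈ Φ.carrier, Subsingleton (Abelian.Ext (ModuleCat.of R (R ⧸ b)) M i)) :
    Function.Surjective (((Φ.gammaComplex I).homologyClass n).compRight R (M := X)) := by
  intro h
  obtain ⟨s, hs⟩ := CochainComplex.exists_section_homologyClass
    (Φ.gammaComplex I) (Φ.gammaComplex_injective I) n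
    (fun i hi x hx => Φ.gammaComplex_exact I i (hM i hi) x hx)
  exact ⟨s ∘ₗ h, LinearMap.ext fun x => hs (h x)⟩

end

section

variable [IsNoetherianRing R] (M : ModuleCat.{u} R) (n : ℕ)
  (hM : ∀ i < n, ∀ b ∈ Φ.carrier, Subsingleton (Abelian.Ext (ModuleCat.of R (R ⧸ b)) M i))

/-- General local cohomology computed by an injective resolution. -/
def generalLocalCohomologyIso (I : InjectiveResolution M) :
    (Φ.gammaComplex I).homology n ≅ (Φ.generalLocalCohomology n).obj M :=
  (I.isoRightDerivedObj Φ.gammaFunctor n).symm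

/-- The equivalence `Ext^n(X, M) ≃ Hom(X, H^n(Γ_Φ(I)))` for an injective resolution `I` of `M`. -/
def abelianExtEquivHom (I : InjectiveResolution M) (X : ModuleCat.{u} R) (hX : Φ.Annihilates X) :
    Abelian.Ext X M n ≃ₗ[R] (X →ₗ[R] (Φ.gammaComplex I).homology n) :=
  LinearMap.equivOfSurjectiveOfKer (Φ.extMkGamma I n X)
    (((Φ.gammaComplex I).homologyClass n).compRight R)
    (Φ.extMkGamma_surjective I n hX) (Φ.homologyClass_comp_surjective I n hM)
    (Φ.extMkGamma_eq_zero_iff I n hX hM)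

theorem abelianExtEquivHom_extMkGamma (I : InjectiveResolution M) {X : ModuleCat.{u} R}
    (hX : Φ.Annihilates X) (f : X →ₗ[R] Φ.gammaCocycles I n) :
    Φ.abelianExtEquivHom M n hM I X hX (Φ.extMkGamma I n X f) =
      (Φ.gammaComplex I).homologyClass n ∘ₗ f :=
  LinearMap.equivOfSurjectiveOfKer_apply _ _ _ _ _ f

theorem abelianExtEquivHom_naturality (I : InjectiveResolution M) {X X' : ModuleCat.{u} R}
    (hX : Φ.Annihilates X) (hX' : Φ.Annihilates X') (g : X ⟶ X') (e : Abelian.Ext X' M n) :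
    Φ.abelianExtEquivHom M n hM I X hX ((Abelian.Ext.mk₀ g).comp e (zero_add _)) =
      Φ.abelianExtEquivHom M n hM I X' hX' e ∘ₗ g.hom := by
  obtain ⟨f, rfl⟩ := Φ.extMkGamma_surjective I n hX' e
  rw [← extMkGamma_comp, abelianExtEquivHom_extMkGamma, abelianExtEquivHom_extMkGamma]
  rfl

/-- If `Ext^i(R/b, M) = 0` for all `i < n` and `b ∈ Φ`, then `Ext^n(X, M) ≃ Hom(X, H^n_Φ(M))` for
every module `X` annihilated by a member of `Φ`. -/
def extEquivHom (X : ModuleCat.{u} R) (hX : Φ.Annihilates X) :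
    ((Ext R (ModuleCat.{u} R) n).obj (Opposite.op X)).obj M ≃ₗ[R]
      (X →ₗ[R] (Φ.generalLocalCohomology n).obj M) :=
  extEquivAbelianExt n X M ≪≫ₗ
    Φ.abelianExtEquivHom M n hM (injectiveResolution M) X hX ≪≫ₗ
    (Φ.generalLocalCohomologyIso M n (injectiveResolution M)).toLinearEquiv.congrRight

theorem extEquivHom_naturality {X X' : ModuleCat.{u} R} (hX : Φ.Annihilates X)
    (hX' : Φ.Annihilates X') (g : X ⟶ X')
    (e : ((Ext R (ModuleCat.{u} R) n).obj (Opposite.op X')).obj M) :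
    Φ.extEquivHom M n hM X hX (((Ext R (ModuleCat.{u} R) n).map g.op).app M e) =
      Φ.extEquivHom M n hM X' hX' e ∘ₗ g.hom := by
  simp only [extEquivHom, LinearEquiv.trans_apply]
  rw [extEquivAbelianExt_naturality, Φ.abelianExtEquivHom_naturality M n hM _ hX hX']
  rfl

end

end IdealSystem

/-! ### Powers of an ideal and direct limits of Ext. -/

/-- A filtered colimit of modules is isomorphic to the point of a cocone that is jointly
surjective and jointly injective in the limit. -/
theorem nonempty_colimit_obj_linearEquiv {R : Type u} [CommRing R] {J : Type} [SmallCategory J]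
    [IsFiltered J] (F : J ⥤ ModuleCat.{u} R ⥤ ModuleCat.{u} R) (M : ModuleCat.{u} R)
    (c : Limits.Cocone (F ⋙ (evaluation _ _).obj M))
    (hsurj : ∀ y : c.pt, ∃ (j : J) (x : (F.obj j).obj M), c.ι.app j x = y)
    (hinj : ∀ (j : J) (x : (F.obj j).obj M), c.ι.app j x = 0 →
      ∃ (k : J) (f : j ⟶ k), (F.map f).app M x = 0) :
    Nonempty ((Limits.colimit F).obj M ≃ₗ[R] c.pt) := by
  let G := F ⋙ (evaluation _ _).obj M
  have : Limits.PreservesFilteredColimitsOfSize.{0, 0} (forget (ModuleCat.{u} R)) :=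
    Limits.preservesFilteredColimitsOfSize_shrink.{0, u, 0, u} _
  have hι : ∀ (j : J) (x : G.obj j), Limits.colimit.desc G c (Limits.colimit.ι G j x) =
      c.ι.app j x := fun j x => ConcreteCategory.congr_hom (Limits.colimit.ι_desc c j) x
  have hbij : Function.Bijective (Limits.colimit.desc G c).hom := by
    constructor
    · refine (injective_iff_map_eq_zero _).2 fun z hz => ?_
      obtain ⟨j, x, rfl⟩ := Limits.Concrete.colimit_exists_rep G z
      obtain ⟨k, f, hf⟩ := hinj j x ((hι j x).symm.trans hz)
      refine (ConcreteCategory.congr_hom (Limits.colimit.w G f) x).symm.trans ?_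
      exact (congrArg (Limits.colimit.ι G k).hom hf).trans (map_zero _)
    · intro y
      obtain ⟨j, x, hx⟩ := hsurj y
      exact ⟨Limits.colimit.ι G j x, (hι j x).trans hx⟩
  exact ⟨(Limits.colimitObjIsoColimitCompEvaluation F M).toLinearEquiv ≪≫ₗ
    LinearEquiv.ofBijective _ hbij⟩

namespace IdealSystem

variable {R : Type u} [CommRing R]

/-- The system of powers of an ideal. -/
def powers (a : Ideal R) : IdealSystem R where
  carrier := Set.range (a ^ · : ℕ → Ideal R)
  nonempty := Set.range_nonempty _
  exists_le_mul := by
    rintro _ ⟨m, rfl⟩ _ ⟨n, rfl⟩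
    exact ⟨a ^ (m + n), ⟨m + n, rfl⟩, (pow_add a m n).le⟩

theorem annihilates_of_powers {Φ : IdealSystem R} {a : Ideal R} (ha : a ∈ Φ.carrier)
    {X : Type u} [AddCommGroup X] [Module R X] (hX : (powers a).Annihilates X) :
    Φ.Annihilates X := by
  obtain ⟨_, ⟨n, rfl⟩, h⟩ := hX
  obtain ⟨K, hK, hle⟩ := Φ.exists_le_pow ha n
  exact ⟨K, hK, fun r hr => h r (hle hr)⟩

theorem powers_annihilates_quotient (a : Ideal R) (n : ℕ) :
    (powers a).Annihilates (R ⧸ a ^ n) := by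
  refine ⟨a ^ n, ⟨n, rfl⟩, fun r hr x => ?_⟩
  obtain ⟨x, rfl⟩ := Submodule.Quotient.mk_surjective _ x
  exact (Submodule.Quotient.mk_eq_zero _).2 ((a ^ n).mul_mem_right x hr)

/-- Linear maps from a module annihilated by a member of `Φ` take values in `Γ_Φ`. -/
def homGammaEquiv {Φ : IdealSystem R} {X : Type u} [AddCommGroup X] [Module R X]
    (hX : Φ.Annihilates X) (H : Type u) [AddCommGroup H] [Module R H] :
    (X →ₗ[R] Φ.gamma H) ≃ₗ[R] (X →ₗ[R] H) where
  toFun f := (Φ.gamma H).subtype ∘ₗ f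
  map_add' _ _ := rfl
  map_smul' _ _ := rfl
  invFun f := LinearMap.codRestrict _ f (hX.map_mem_gamma f)
  left_inv _ := rfl
  right_inv _ := rfl

theorem powers_annihilates_of_support_eq [IsNoetherianRing R] (a : Ideal R) (N : Type u)
    [AddCommGroup N] [Module R N] [Module.Finite R N]
    (hN : Module.support R N = PrimeSpectrum.zeroLocus (a : Set R)) :
    (powers a).Annihilates N := by
  rw [Module.support_eq_zeroLocus] at hN
  -- `V(ann N) ⊆ V(a)` puts the finitely generated ideal `a` inside the radical of `ann N`.
  obtain ⟨k, hk⟩ := Ideal.exists_pow_le_of_le_radical_of_fg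
    ((PrimeSpectrum.zeroLocus_subset_zeroLocus_iff _ _).1 hN.le) (IsNoetherian.noetherian a)
  exact ⟨a ^ k, ⟨k, rfl⟩, fun r hr x => Module.mem_annihilator.1 (hk hr) x⟩

end IdealSystem

section

variable {R : Type u} [CommRing R]

/-- If `a^k N = 0`, then `N → N/a^m N` is an isomorphism for `m ≥ k`, so the system of Ext modules
is eventually constant. -/
theorem nonempty_generalizedLocalCohomology_linearEquiv_ext (a : Ideal R) (n : ℕ) (N : Type u)
    [AddCommGroup N] [Module R N] (hN : (IdealSystem.powers a).Annihilates N)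
    (M : ModuleCat.{u} R) :
    Nonempty ((generalizedLocalCohomology a n N).obj M ≃ₗ[R]
      ((Ext R (ModuleCat.{u} R) n).obj (Opposite.op (ModuleCat.of R N))).obj M) := by
  obtain ⟨_, ⟨k, rfl⟩, hk⟩ := hN
  let p (m : ℕ) : ModuleCat.of R N ⟶ ModuleCat.of R (N ⧸ (a ^ m • ⊤ : Submodule R N)) :=
    ModuleCat.ofHom (Submodule.mkQ _)
  have hiso : ∀ m, k ≤ m → IsIso (p m) := by
    intro m hm
    have hbot : (a ^ m • ⊤ : Submodule R N) = ⊥ := by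
      refine le_bot_iff.1 (Submodule.smul_le.2 fun r hr x _ => ?_)
      exact hk r (Ideal.pow_le_pow_right hm hr) x
    rw [ConcreteCategory.isIso_iff_bijective]
    refine ⟨?_, Submodule.mkQ_surjective _⟩
    exact LinearMap.ker_eq_bot.1 ((Submodule.ker_mkQ _).trans hbot)
  let F := (quotientPowersDiagram a N).op ⋙ Ext R (ModuleCat.{u} R) n
  let c : Limits.Cocone (F ⋙ (evaluation _ _).obj M) :=
    { pt := ((Ext R (ModuleCat.{u} R) n).obj (Opposite.op (ModuleCat.of R N))).obj M
      ι :=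
        { app := fun j => ((Ext R (ModuleCat.{u} R) n).map (p j.unop.unop).op).app M
          naturality := fun i j f => by
            refine Eq.trans ?_ (Category.comp_id _).symm
            have h := (Ext R (ModuleCat.{u} R) n).map_comp
              ((quotientPowersDiagram a N).op.map f) (p j.unop.unop).op
            exact (congrArg (fun q => NatTrans.app q M) h).symm } }
  have hcbij : ∀ j : ℕᵒᵖᵒᵖ, k ≤ j.unop.unop → Function.Bijective (c.ι.app j) := by
    intro j hj
    have := hiso _ hj
    have : IsIso (((Ext R (ModuleCat.{u} R) n).map (p j.unop.unop).op).app M) := inferInstance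
    exact (ConcreteCategory.isIso_iff_bijective
      (((Ext R (ModuleCat.{u} R) n).map (p j.unop.unop).op).app M)).1 this
  refine nonempty_colimit_obj_linearEquiv F M c (fun y => ?_) (fun j x hx => ?_)
  · obtain ⟨x, hx⟩ := (hcbij (.op (.op k)) le_rfl).2 y
    exact ⟨_, x, hx⟩
  · let l : ℕᵒᵖᵒᵖ := .op (.op (max j.unop.unop k))
    let f : j ⟶ l := (homOfLE (le_max_left j.unop.unop k)).op.op
    refine ⟨l, f, (hcbij l (le_max_right _ _)).1 ?_⟩
    refine (ConcreteCategory.congr_hom (c.w f) x).trans (hx.trans ?_)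
    exact (map_zero (c.ι.app l).hom).symm

/-- Evaluation at `1` identifies `Ext^n(R/a^m, M) ≅ Hom(R/a^m, H)` with the elements of `H` killed
by `a^m`, whose union over `m` is `Γ_a(H)`. -/
theorem nonempty_localCohomology_linearEquiv_gamma [IsNoetherianRing R] (Φ : IdealSystem R)
    (a : Ideal R) (ha : a ∈ Φ.carrier) (M : ModuleCat.{u} R) (n : ℕ)
    (hM : ∀ i < n, ∀ b ∈ Φ.carrier, Subsingleton (Abelian.Ext (ModuleCat.of R (R ⧸ b)) M i)) :
    Nonempty ((localCohomology a n).obj M ≃ₗ[R]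
      (IdealSystem.powers a).gamma ((Φ.generalLocalCohomology n).obj M)) := by
  let H := (Φ.generalLocalCohomology n).obj M
  have hp (m : ℕ) := IdealSystem.powers_annihilates_quotient a m
  let φ (m : ℕ) := Φ.extEquivHom M n hM (ModuleCat.of R (R ⧸ a ^ m))
    (IdealSystem.annihilates_of_powers ha (hp m))
  let F := localCohomology.diagram (localCohomology.idealPowersDiagram a) n
  let one (m : ℕ) : R ⧸ a ^ m := Submodule.Quotient.mk 1
  let ev (m : ℕ) : ((Ext R (ModuleCat.{u} R) n).obj
      (Opposite.op (ModuleCat.of R (R ⧸ a ^ m)))).obj M →ₗ[R] (IdealSystem.powers a).gamma H :=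
    LinearMap.codRestrict _ (LinearMap.applyₗ (one m) ∘ₗ (φ m).toLinearMap)
      (fun e => (hp m).map_mem_gamma (φ m e) (one m))
  let c : Limits.Cocone (F ⋙ (evaluation _ _).obj M) :=
    { pt := ModuleCat.of R ((IdealSystem.powers a).gamma H)
      ι :=
        { app := fun j => ModuleCat.ofHom (ev j.unop.unop)
          naturality := fun i j f => by
            refine Eq.trans ?_ (Category.comp_id _).symm
            ext e
            refine Subtype.ext ?_
            exact LinearMap.congr_fun (Φ.extEquivHom_naturality M n hM
              (IdealSystem.annihilates_of_powers ha (hp j.unop.unop))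
              (IdealSystem.annihilates_of_powers ha (hp i.unop.unop))
              ((localCohomology.ringModIdeals (localCohomology.idealPowersDiagram a)).map f.unop)
              e) (one j.unop.unop) } }
  refine nonempty_colimit_obj_linearEquiv F M c (fun y => ?_) (fun j x hx => ?_)
  · obtain ⟨_, ⟨m, rfl⟩, hy⟩ := y.2
    refine ⟨.op (.op m), (φ m).symm
      (Submodule.liftQ _ (LinearMap.toSpanSingleton R _ y.1) hy), Subtype.ext ?_⟩
    refine (LinearMap.congr_fun ((φ m).apply_symm_apply _) (one m)).trans ?_
    exact one_smul R y.1
  -- No passage to a later stage is needed: a map out of `R/a^m` is determined by its value at `1`.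
  · refine ⟨j, 𝟙 j, ?_⟩
    have h1 : φ j.unop.unop x (one _) = 0 := congrArg Subtype.val hx
    have h2 : φ j.unop.unop x = 0 := by
      ext
      exact h1
    have h3 : x = 0 := (map_eq_zero_iff _ (φ j.unop.unop).injective).1 h2
    rw [h3]
    exact map_zero ((F.map (𝟙 j)).app M).hom

end

end

theorem corollary4p9 {R : Type u} [CommRing R] [IsNoetherianRing R] (Φ : IdealSystem R)
    (M N : Type u) [AddCommGroup M] [Module R M] [Module.Finite R M]
    [AddCommGroup N] [Module R N] [Module.Finite R N]
    (a : Ideal R) (ha : a ∈ Φ.carrier)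
    (hN : Module.support R N = PrimeSpectrum.zeroLocus (a : Set R))
    (t : ℕ) (ht : Φ.grade M = t) :
    Nonempty ((N →ₗ[R] (Φ.generalLocalCohomology t).obj (ModuleCat.of R M)) ≃ₗ[R]
      ((Ext R (ModuleCat.{u} R) t).obj (Opposite.op (ModuleCat.of R N))).obj
        (ModuleCat.of R M)) ∧
    Nonempty (((Ext R (ModuleCat.{u} R) t).obj (Opposite.op (ModuleCat.of R N))).obj
        (ModuleCat.of R M) ≃ₗ[R]
      (generalizedLocalCohomology a t N).obj (ModuleCat.of R M)) ∧
    Nonempty ((generalizedLocalCohomology a t N).obj (ModuleCat.of R M) ≃ₗ[R]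
      (N →ₗ[R] (localCohomology a t).obj (ModuleCat.of R M))) := by
  have hM : ∀ i < t, ∀ b ∈ Φ.carrier,
      Subsingleton (Abelian.Ext (ModuleCat.of R (R ⧸ b)) (ModuleCat.of R M) i) := by
    intro i hi b hb
    refine subsingleton_ext_of_lt_idealGrade b M i ?_
    calc (i : ℕ∞) < t := by exact_mod_cast hi
      _ = Φ.grade M := ht.symm
      _ ≤ idealGrade b M := iInf₂_le b hb
  have hpow := IdealSystem.powers_annihilates_of_support_eq a N hN
  let e₁ := Φ.extEquivHom (ModuleCat.of R M) t hM (ModuleCat.of R N)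
    (IdealSystem.annihilates_of_powers ha hpow)
  obtain ⟨e₂⟩ := nonempty_generalizedLocalCohomology_linearEquiv_ext a t N hpow (ModuleCat.of R M)
  obtain ⟨e₃⟩ := nonempty_localCohomology_linearEquiv_gamma Φ a ha (ModuleCat.of R M) t hM
  refine ⟨⟨e₁.symm⟩, ⟨e₂.symm⟩, ⟨e₂ ≪≫ₗ e₁ ≪≫ₗ ?_⟩⟩
  -- A power of `a` kills `N`, so maps from `N` to `H^t_Φ(M)` factor through its `a`-power torsion,
  -- which is `H^t_a(M)`.
  exact (IdealSystem.homGammaEquiv hpow _).symm ≪≫ₗ e₃.symm.congrRight
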